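/- Call a \emph{graph} $G$ with $N$ nodes a discrete measure network: nodes $v_1,\dots,v_N$, a mass vector $\mathbf m\in\mathbb R^N$ with $m_i>0$ and $\sum_i m_i=1$, and a node similarity matrix $S\in\mathbb R^{N\times N}$. Put $W=\mathrm{diag}(m_1,\dots,m_N)$ and $U=W^{1/2}SW^{1/2}$. For a partition of the nodes into nonempty blocks $\mathcal P_1,\dots,\mathcal P_n$ let $C_p\in\{0,1\}^{n\times N}$ be the membership matrix, $C_p(k,i)=1$ if and only if $v_i\in\mathcal P_k$, let $c_k=\sum_{v_i\in\mathcal P_k}m_i$, and let $$\bar C_w=\mathrm{diag}(c_1^{-1},\dots,c_n^{-1})\,C_pW,\qquad C_w=\mathrm{diag}(c_1^{-1/2},\dots,c_n^{-1/2})\,C_pW^{1/2}.$$ The coarsened graph $G^{(c)}$ has $n$ nodes, masses $c_1,\dots,c_n$ and similarity matrix $S^{(c)}=\bar C_wS\bar C_w^{\top}$; let $U^{(c)}=C_wUC_w^{\top}$. For two graphs, $\mathrm{GW}_2\ge 0$ is defined by $$\mathrm{GW}_2^2(G_1,G_2)=\min_{T}\sum_{i,j=1}^{N_1}\sum_{i',j'=1}^{N_2}|s^{1}_{ij}-s^{2}_{i'j'}|^2\,T_{ii'}T_{jj'},$$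 the minimum being over entrywise nonnegative $T\in\mathbb R^{N_1\times N_2}$ with $T\mathbf 1=\mathbf m_1$ and $T^{\top}\mathbf 1=\mathbf m_2$. \textbf{Theorem.} Let $G_1,G_2$ be graphs with $N_1,N_2$ nodes whose similarity matrices $S_1,S_2$ are symmetric positive semi-definite, and let $G_1^{(c)},G_2^{(c)}$ be coarsenings of them with $n_1,n_2$ nodes, given by partitions. For $k=1,2$ attach the subscript $k$ to the quantities above, let $\lambda_{k,1}\ge\dots\ge\lambda_{k,N_k}$ be the eigenvalues of $U_k$ and $\lambda^{(c)}_{k,1}\ge\dots\ge\lambda^{(c)}_{k,n_k}$ those of $U_k^{(c)}$ (with multiplicity), and put $$\Delta_k=\sum_{i=1}^{n_k}\bigl(\lambda_{k,i}-\lambda_{k,i}^{(c)}\bigr),\qquad C_{U_k,n_k}=\sum_{i=1}^{n_k}\lambda_{k,i}(\lambda_{k,i}-\lambda_{k,N_k-n_k+i})+\sum_{i=n_k+1}^{N_k}\lambda_{k,i}^2 .$$ Let $T^*$ be any optimal transport plan for $\mathrm{GW}_2(G_1,G_2)$ and $P=W_1^{-1/2}T^*W_2^{-1/2}$. Let $V_1=PW_2^{1/2}S_2W_2^{1/2}P^{\top}$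 and $V_2=P^{\top}W_1^{1/2}S_1W_1^{1/2}P$, let $\nu_{k,1}\ge\dots\ge\nu_{k,N_k}$ be the eigenvalues of $V_k$, and put $$C_{U_k,V_k,n_k}=\sum_{i=1}^{n_k}\lambda_{k,i}(\nu_{k,i}-\nu_{k,N_k-i+1})+\sum_{i=n_k+1}^{N_k}\lambda_{k,i}\nu_{k,i}.$$ The quantities $\lambda_{k,i}$, $C_{U_k,n_k}$, $\nu_{k,i}$, $C_{U_k,V_k,n_k}$ do not depend on the partitions other than through $n_k$. Then $$\bigl|\mathrm{GW}_2^2(G_1^{(c)},G_2^{(c)})-\mathrm{GW}_2^2(G_1,G_2)\bigr|\le\max\Bigl\{\sum_{k=1}^2\bigl[\lambda_{k,N_k-n_k+1}\Delta_k+C_{U_k,n_k}\bigr],\;2\sum_{k=1}^2\bigl[\nu_{k,N_k-n_k+1}\Delta_k+C_{U_k,V_k,n_k}\bigr]\Bigr\}.$$ -/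

import Mathlib

open scoped Matrix

namespace GraphCoarsening

noncomputable section

/-- A graph on the nodes `v_1, …, v_N`, viewed as a discrete measure network: a fully supported
probability mass on the nodes and a real node similarity matrix. The mass and the similarity need
not be related to the edge weights of the graph, which play no other role. -/
structure MeasureGraph (N : ℕ) where
  mass : Fin N → ℝ
  sim : Matrix (Fin N) (Fin N) ℝ
  mass_pos : ∀ i, 0 < mass i
  mass_sum : ∑ i, mass i = 1

/-- A partition `P_1, …, P_n` of the `N` nodes into `n` nonempty blocks. -/
structure NodePartition (N n : ℕ) where
  block : Fin n → Finset (Fin N)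
  nonempty : ∀ k, (block k).Nonempty
  exists_unique_mem : ∀ i, ∃! k, i ∈ block k

/-- The membership matrix `C_p`. -/
def NodePartition.Cp {N n : ℕ} (P : NodePartition N n) : Matrix (Fin n) (Fin N) ℝ :=
  Matrix.of fun k i => if i ∈ P.block k then 1 else 0

namespace MeasureGraph

variable {N N₁ N₂ n : ℕ}

/-- The diagonal mass matrix `W`. -/
def W (G : MeasureGraph N) : Matrix (Fin N) (Fin N) ℝ := Matrix.diagonal G.mass

/-- `W^{1/2}`. -/
def sqrtW (G : MeasureGraph N) : Matrix (Fin N) (Fin N) ℝ :=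
  Matrix.diagonal fun i => √(G.mass i)

/-- `W^{-1/2}`; all masses are positive. -/
def invSqrtW (G : MeasureGraph N) : Matrix (Fin N) (Fin N) ℝ :=
  Matrix.diagonal fun i => (√(G.mass i))⁻¹

/-- The accumulated mass `c_k` of the `k`-th block. -/
def blockMass (G : MeasureGraph N) (P : NodePartition N n) (k : Fin n) : ℝ :=
  ∑ i ∈ P.block k, G.mass i

/-- The averaging coarsening matrix `diag(c⁻¹) C_p W`. -/
def CwBar (G : MeasureGraph N) (P : NodePartition N n) : Matrix (Fin n) (Fin N) ℝ :=
  Matrix.diagonal (fun k => (G.blockMass P k)⁻¹) * P.Cp * G.W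

/-- The projection coarsening matrix `C_w = diag(c^{-1/2}) C_p W^{1/2}`. -/
def Cw (G : MeasureGraph N) (P : NodePartition N n) : Matrix (Fin n) (Fin N) ℝ :=
  Matrix.diagonal (fun k => (√(G.blockMass P k))⁻¹) * P.Cp * G.sqrtW

theorem blockMass_pos (G : MeasureGraph N) (P : NodePartition N n) (k : Fin n) :
    0 < G.blockMass P k :=
  Finset.sum_pos (fun i _ => G.mass_pos i) (P.nonempty k)

theorem sum_blockMass (G : MeasureGraph N) (P : NodePartition N n) :
    ∑ k, G.blockMass P k = 1 := by
  have hd : ∀ k ∈ (Finset.univ : Finset (Fin n)), ∀ l ∈ (Finset.univ : Finset (Fin n)),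
      k ≠ l → Disjoint (P.block k) (P.block l) := by
    intro k _ l _ hkl
    rw [Finset.disjoint_left]
    intro i hi hj
    exact hkl ((P.exists_unique_mem i).unique hi hj)
  have hu : Finset.univ.biUnion P.block = Finset.univ := by
    ext i
    obtain ⟨k, hk, _⟩ := P.exists_unique_mem i
    simpa using ⟨k, hk⟩
  unfold blockMass
  rw [← Finset.sum_biUnion hd, hu, G.mass_sum]

/-- The coarsened graph `G^{(c)}`: its masses are the accumulated masses of the blocks and its
similarity matrix is the averaged one. -/
def coarsen (G : MeasureGraph N) (P : NodePartition N n) : MeasureGraph n where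
  mass := G.blockMass P
  sim := G.CwBar P * G.sim * (G.CwBar P)ᵀ
  mass_pos := G.blockMass_pos P
  mass_sum := G.sum_blockMass P

/-- The feasible transport matrices between two graphs. -/
def couplings (G₁ : MeasureGraph N₁) (G₂ : MeasureGraph N₂) :
    Set (Matrix (Fin N₁) (Fin N₂) ℝ) :=
  {T | (∀ i j, 0 ≤ T i j) ∧ (∀ i, ∑ j, T i j = G₁.mass i) ∧ ∀ j, ∑ i, T i j = G₂.mass j}

/-- The quadratic transport cost of `T`. -/
def cost (G₁ : MeasureGraph N₁) (G₂ : MeasureGraph N₂) (T : Matrix (Fin N₁) (Fin N₂) ℝ) : ℝ :=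
  ∑ i, ∑ j, ∑ i', ∑ j', |G₁.sim i j - G₂.sim i' j'| ^ 2 * T i i' * T j j'

/-- `T` is an optimal transport plan for the Gromov–Wasserstein problem. -/
def IsOptimalPlan (G₁ : MeasureGraph N₁) (G₂ : MeasureGraph N₂)
    (T : Matrix (Fin N₁) (Fin N₂) ℝ) : Prop :=
  T ∈ couplings G₁ G₂ ∧ ∀ T' ∈ couplings G₁ G₂, cost G₁ G₂ T ≤ cost G₁ G₂ T'

/-- Optimal plans exist, so that the infimum in `GW2` is a minimum. -/
theorem exists_isOptimalPlan (G₁ : MeasureGraph N₁) (G₂ : MeasureGraph N₂) :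
    ∃ T, IsOptimalPlan G₁ G₂ T := by
  have hne : (couplings G₁ G₂).Nonempty := by
    refine ⟨Matrix.of fun i j => G₁.mass i * G₂.mass j, ?_, ?_, ?_⟩
    · intro i j
      exact mul_nonneg (G₁.mass_pos i).le (G₂.mass_pos j).le
    · intro i
      simp [← Finset.mul_sum, G₂.mass_sum]
    · intro j
      simp [← Finset.sum_mul, G₁.mass_sum]
  have hent : ∀ (i : Fin N₁) (j : Fin N₂),
      Continuous fun T : Fin N₁ → Fin N₂ → ℝ => T i j := by
    intro i j
    fun_prop
  have hcl : IsClosed (X := Fin N₁ → Fin N₂ → ℝ) (couplings G₁ G₂) := by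
    have h1 : IsClosed {T : Fin N₁ → Fin N₂ → ℝ | ∀ i j, 0 ≤ T i j} := by
      rw [show {T : Fin N₁ → Fin N₂ → ℝ | ∀ i j, 0 ≤ T i j} = ⋂ i, ⋂ j, {T | 0 ≤ T i j} by
        ext; simp]
      exact isClosed_iInter fun i => isClosed_iInter fun j =>
        isClosed_le continuous_const (hent i j)
    have h2 : IsClosed {T : Fin N₁ → Fin N₂ → ℝ | ∀ i, ∑ j, T i j = G₁.mass i} := by
      rw [show {T : Fin N₁ → Fin N₂ → ℝ | ∀ i, ∑ j, T i j = G₁.mass i} =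
        ⋂ i, {T | ∑ j, T i j = G₁.mass i} by ext; simp]
      exact isClosed_iInter fun i =>
        isClosed_eq (continuous_finsetSum _ fun j _ => hent i j) continuous_const
    have h3 : IsClosed {T : Fin N₁ → Fin N₂ → ℝ | ∀ j, ∑ i, T i j = G₂.mass j} := by
      rw [show {T : Fin N₁ → Fin N₂ → ℝ | ∀ j, ∑ i, T i j = G₂.mass j} =
        ⋂ j, {T | ∑ i, T i j = G₂.mass j} by ext; simp]
      exact isClosed_iInter fun j =>
        isClosed_eq (continuous_finsetSum _ fun i _ => hent i j) continuous_const
    exact h1.inter (h2.inter h3)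
  have hsub : couplings G₁ G₂ ⊆
      Set.pi Set.univ fun i => Set.pi Set.univ fun _ : Fin N₂ => Set.Icc 0 (G₁.mass i) := by
    intro T hT i _ j _
    refine ⟨hT.1 i j, ?_⟩
    rw [← hT.2.1 i]
    exact Finset.single_le_sum (fun k _ => hT.1 i k) (Finset.mem_univ j)
  have hc : IsCompact (X := Fin N₁ → Fin N₂ → ℝ) (couplings G₁ G₂) :=
    (isCompact_univ_pi fun i => isCompact_univ_pi fun _ => isCompact_Icc).of_isClosed_subset hcl hsub
  have hcont : Continuous fun T : Fin N₁ → Fin N₂ → ℝ => cost G₁ G₂ T := by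
    unfold cost
    fun_prop
  obtain ⟨T, hT, hmin⟩ := hc.exists_isMinOn hne hcont.continuousOn
  exact ⟨T, hT, fun T' hT' => hmin hT'⟩

/-- The Gromov–Wasserstein distance `GW_2`; its square is the minimal cost. -/
def GW2 (G₁ : MeasureGraph N₁) (G₂ : MeasureGraph N₂) : ℝ :=
  √(sInf (cost G₁ G₂ '' couplings G₁ G₂))

/-- `U = W^{1/2} S W^{1/2}`. -/
def U (G : MeasureGraph N) : Matrix (Fin N) (Fin N) ℝ := G.sqrtW * G.sim * G.sqrtW

/-- `U^{(c)} = C_w U C_wᵀ`. -/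
def Uc (G : MeasureGraph N) (P : NodePartition N n) : Matrix (Fin n) (Fin n) ℝ :=
  G.Cw P * G.U * (G.Cw P)ᵀ

end MeasureGraph

/-- The `i`-th largest eigenvalue of a real symmetric `N × N` matrix, counted with multiplicity,
for `1 ≤ i ≤ N` (the value `0` is a placeholder outside of this range). -/
def eig {N : ℕ} (A : Matrix (Fin N) (Fin N) ℝ) (i : ℕ) : ℝ :=
  if h : A.IsHermitian ∧ 1 ≤ i ∧ i ≤ N then
    h.1.eigenvalues₀ ⟨i - 1, by rw [Fintype.card_fin]; omega⟩
  else 0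

/-- `C_{U,n}`, with `λ_i = eig U i`. -/
def constU {N : ℕ} (U : Matrix (Fin N) (Fin N) ℝ) (n : ℕ) : ℝ :=
  ∑ i ∈ Finset.Icc 1 n, eig U i * (eig U i - eig U (N - n + i))
    + ∑ i ∈ Finset.Icc (n + 1) N, eig U i ^ 2

/-- `C_{U,V,n}`, with `λ_i = eig U i` and `ν_i = eig V i`. -/
def constUV {N : ℕ} (U V : Matrix (Fin N) (Fin N) ℝ) (n : ℕ) : ℝ :=
  ∑ i ∈ Finset.Icc 1 n, eig U i * (eig V i - eig V (N - i + 1))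
    + ∑ i ∈ Finset.Icc (n + 1) N, eig U i * eig V i

namespace MeasureGraph

variable {N N₁ N₂ n : ℕ}

/-- The spectral difference `Δ` between a graph and its coarsening. -/
def specDiff (G : MeasureGraph N) (P : NodePartition N n) : ℝ :=
  ∑ i ∈ Finset.Icc 1 n, (eig G.U i - eig (G.Uc P) i)

/-- The normalized plan `W₁^{-1/2} T W₂^{-1/2}`. -/
def normPlan (G₁ : MeasureGraph N₁) (G₂ : MeasureGraph N₂) (T : Matrix (Fin N₁) (Fin N₂) ℝ) :
    Matrix (Fin N₁) (Fin N₂) ℝ :=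
  G₁.invSqrtW * T * G₂.invSqrtW

/-- `V₁ = P W₂^{1/2} S₂ W₂^{1/2} Pᵀ` for the normalized plan `P` of `T`. -/
def V₁ (G₁ : MeasureGraph N₁) (G₂ : MeasureGraph N₂) (T : Matrix (Fin N₁) (Fin N₂) ℝ) :
    Matrix (Fin N₁) (Fin N₁) ℝ :=
  normPlan G₁ G₂ T * G₂.sqrtW * G₂.sim * G₂.sqrtW * (normPlan G₁ G₂ T)ᵀ

/-- `V₂ = Pᵀ W₁^{1/2} S₁ W₁^{1/2} P` for the normalized plan `P` of `T`. -/
def V₂ (G₁ : MeasureGraph N₁) (G₂ : MeasureGraph N₂) (T : Matrix (Fin N₁) (Fin N₂) ℝ) :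
    Matrix (Fin N₂) (Fin N₂) ℝ :=
  (normPlan G₁ G₂ T)ᵀ * G₁.sqrtW * G₁.sim * G₁.sqrtW * normPlan G₁ G₂ T

end MeasureGraph

end

end GraphCoarsening

open GraphCoarsening

/-! In the normalized variables `U` and Q = W₁^{-1/2} T W₂^{-1/2}, the cost of a coupling is tr U₁²
+ tr U₂² − 2 tr(U₁ Q U₂ Qᵀ) (`cost_eq`). Coarsening replaces each U by its compression C U Cᵀ, where
C = `Cw` has orthonormal rows (`U_coarsen`, `Cw_mul_transpose_Cw`). Plans pass in both directions: Q
projects to C₁ Q C₂ᵀ, and a coarse Q lifts to C₁ᵀ Q C₂.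

Lifting an optimal coarse plan leaves the cross term unchanged, so the squared distance can drop by
at most the losses ‖U‖² − ‖C U Cᵀ‖² (`GW2_sq_le_coarsen`). For the other direction, project T* and
put X = C₁ᵀC₁U₁C₁ᵀC₁, with Y likewise for the second graph. The change of the cross term is the sum
of the two one-sided changes, tr((U₁−X)V₁) and tr((U₂−Y)V₂), minus tr((U₁−X)Q(U₂−Y)Qᵀ). Twice that
mixed term is absorbed by ‖U₁−X‖² + ‖U₂−Y‖², which is exactly the amount by which the quadratic
terms decrease (`GW2_coarsen_sq_le`).

What remains is spectral: bounding tr(AB) − tr((CACᵀ)(CBCᵀ)). Cauchy interlacing and the two-sided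
von Neumann trace inequality reduce it to scalar inequalities, one for each index. -/

namespace GraphCoarsening

/-! ### Ordered eigenvalues and Cauchy interlacing -/

theorem eig_antitone {N : ℕ} (A : Matrix (Fin N) (Fin N) ℝ) {i j : ℕ} (hi : 1 ≤ i) (hij : i ≤ j)
    (hj : j ≤ N) : eig A j ≤ eig A i := by
  by_cases hA : A.IsHermitian
  · rw [eig, eig, dif_pos ⟨hA, hi.trans hij, hj⟩, dif_pos ⟨hA, hi, hij.trans hj⟩]
    exact hA.eigenvalues₀_antitone (Fin.mk_le_mk.2 (by omega))
  · rw [eig, eig, dif_neg (fun h => hA h.1), dif_neg (fun h => hA h.1)]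

/-- The spectral theorem, with the eigenvalues in decreasing order. -/
theorem exists_orthogonal_diagonalization {N : ℕ} {A : Matrix (Fin N) (Fin N) ℝ}
    (hA : A.IsHermitian) :
    ∃ Q : Matrix (Fin N) (Fin N) ℝ, Qᵀ * Q = 1 ∧ Q * Qᵀ = 1 ∧
      A = Q * Matrix.diagonal (fun i : Fin N => eig A (i + 1)) * Qᵀ := by
  let e : Fin (Fintype.card (Fin N)) ≃ Fin N := Fintype.equivOfCardEq (Fintype.card_fin _)
  -- `eigenvalues` is indexed through an arbitrary equivalence; σ restores the decreasing order of
  -- `eigenvalues₀`.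
  let σ : Fin N ≃ Fin N := (finCongr (Fintype.card_fin N).symm).trans e
  have hσ : ∀ i : Fin N, eig A (i + 1) = hA.eigenvalues (σ i) := by
    intro i
    rw [eig, dif_pos ⟨hA, by omega, by omega⟩, Matrix.IsHermitian.eigenvalues]
    congr 1
    simp only [σ, e, Equiv.trans_apply, Equiv.symm_apply_apply]
    ext
    simp
  let Q₀ : Matrix (Fin N) (Fin N) ℝ := hA.eigenvectorUnitary
  have h1 : Q₀ᵀ * Q₀ = 1 := by
    have := Unitary.coe_star_mul_self hA.eigenvectorUnitary
    rwa [Matrix.star_eq_conjTranspose, Matrix.conjTranspose_eq_transpose_of_trivial] at this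
  have hsub : (Q₀.submatrix id σ)ᵀ * Q₀.submatrix id σ = 1 := by
    rw [Matrix.transpose_submatrix, ← Matrix.submatrix_mul _ _ _ _ _ Function.bijective_id, h1]
    simp
  refine ⟨Q₀.submatrix id σ, hsub, mul_eq_one_comm.1 hsub, ?_⟩
  have h2 : A = Q₀ * Matrix.diagonal hA.eigenvalues * Q₀ᵀ := by
    have := hA.spectral_theorem
    rwa [Unitary.conjStarAlgAut_apply, Matrix.star_eq_conjTranspose,
      Matrix.conjTranspose_eq_transpose_of_trivial] at this
  have h3 : Matrix.diagonal (fun i : Fin N => eig A (i + 1))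
      = (Matrix.diagonal hA.eigenvalues).submatrix σ σ := by
    rw [Matrix.submatrix_diagonal_equiv]
    congr 1
    funext i
    exact hσ i
  rw [h3, Matrix.transpose_submatrix, Matrix.submatrix_mul_equiv, Matrix.submatrix_mul_equiv, ← h2]
  simp

theorem sum_Icc_one_eq_sum_fin (N : ℕ) (f : ℕ → ℝ) :
    ∑ i ∈ Finset.Icc 1 N, f i = ∑ i : Fin N, f (i + 1) := by
  rw [Fin.sum_univ_eq_sum_range (fun i => f (i + 1)), Finset.range_eq_Ico, Finset.sum_Ico_add']
  rfl

/-- A quadratic form `∑ d_j z_j²` as a dot product. -/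
theorem dotProduct_diagonal_mulVec {m : ℕ} (d : Fin m → ℝ) (z : Fin m → ℝ) :
    z ⬝ᵥ (Matrix.diagonal d *ᵥ z) = ∑ j, d j * z j ^ 2 := by
  simp only [dotProduct, Matrix.mulVec_diagonal]
  exact Finset.sum_congr rfl fun j _ => by ring

/-- If `Xᵀ X = 1` and `Xᵀ diag(d) X = diag(e)` with `d` and `e` decreasing, then `e_i ≤ d_i`. -/
theorem diagonal_compression_le {N n : ℕ} (d e : ℕ → ℝ)
    (hd : ∀ i j, i ≤ j → j < N → d j ≤ d i) (he : ∀ i j, i ≤ j → j < n → e j ≤ e i)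
    (X : Matrix (Fin N) (Fin n) ℝ) (hX : Xᵀ * X = 1)
    (hXd : Xᵀ * Matrix.diagonal (fun i : Fin N => d i) * X = Matrix.diagonal (fun i : Fin n => e i))
    {i : ℕ} (hi : i < n) (hnN : n ≤ N) : e i ≤ d i := by
  -- Courant–Fischer: among vectors supported on the first i + 1 coordinates, i linear conditions
  -- leave a nonzero y whose image under X vanishes in its first i coordinates. The common value of
  -- the two quadratic forms is then at least e_i ‖y‖² and at most d_i ‖X y‖² = d_i ‖y‖².
  let emb : (Fin (i + 1) → ℝ) →ₗ[ℝ] (Fin n → ℝ) :=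
    LinearMap.pi fun k => if h : (k : ℕ) < i + 1 then LinearMap.proj ⟨k, h⟩ else 0
  let L : (Fin (i + 1) → ℝ) →ₗ[ℝ] (Fin i → ℝ) :=
    (LinearMap.funLeft ℝ ℝ (Fin.castLE (by omega : i ≤ N))) ∘ₗ X.mulVecLin ∘ₗ emb
  obtain ⟨y, hyL, hy0⟩ := (Submodule.ne_bot_iff _).1
    (LinearMap.ker_ne_bot_of_finrank_lt (f := L) (by simp))
  have hemb : ∀ k : Fin n, emb y k = if h : (k : ℕ) < i + 1 then y ⟨k, h⟩ else 0 := by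
    intro k
    simp only [emb, LinearMap.pi_apply]
    split_ifs <;> simp
  have hz0 : ∀ j : Fin N, (j : ℕ) < i → (X *ᵥ emb y) j = 0 := by
    intro j hj
    have := congrFun (LinearMap.mem_ker.1 hyL) ⟨j, hj⟩
    simpa [L, LinearMap.funLeft_apply] using this
  have hnorm : (X *ᵥ emb y) ⬝ᵥ (X *ᵥ emb y) = emb y ⬝ᵥ emb y := by
    rw [Matrix.dotProduct_mulVec, ← Matrix.mulVec_transpose, Matrix.mulVec_mulVec, hX,
      Matrix.one_mulVec]
  have hquad : (X *ᵥ emb y) ⬝ᵥ (Matrix.diagonal (fun i : Fin N => d i) *ᵥ (X *ᵥ emb y))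
      = emb y ⬝ᵥ (Matrix.diagonal (fun i : Fin n => e i) *ᵥ emb y) := by
    rw [← hXd, dotProduct_comm, Matrix.dotProduct_mulVec, ← Matrix.mulVec_transpose,
      dotProduct_comm]
    simp only [Matrix.mulVec_mulVec, Matrix.mul_assoc]
  have hpos : 0 < emb y ⬝ᵥ emb y := by
    obtain ⟨k, hk⟩ := Function.ne_iff.1 hy0
    refine Finset.sum_pos' (fun j _ => mul_self_nonneg _)
      ⟨⟨k, by omega⟩, Finset.mem_univ _, mul_self_pos.2 ?_⟩
    rw [hemb, dif_pos k.2]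
    exact hk
  rw [dotProduct_diagonal_mulVec, dotProduct_diagonal_mulVec] at hquad
  have h1 : e i * (emb y ⬝ᵥ emb y) ≤ ∑ k : Fin n, e k * emb y k ^ 2 := by
    rw [dotProduct, Finset.mul_sum]
    refine Finset.sum_le_sum fun k _ => ?_
    rw [← pow_two]
    by_cases hk : (k : ℕ) < i + 1
    · exact mul_le_mul_of_nonneg_right (he _ _ (by omega) hi) (sq_nonneg _)
    · rw [hemb, dif_neg hk]
      simp
  have h2 : ∑ j : Fin N, d j * (X *ᵥ emb y) j ^ 2 ≤ d i * (emb y ⬝ᵥ emb y) := by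
    rw [← hnorm, dotProduct, Finset.mul_sum]
    refine Finset.sum_le_sum fun j _ => ?_
    rw [← pow_two]
    by_cases hj : (j : ℕ) < i
    · rw [hz0 j hj]
      simp
    · exact mul_le_mul_of_nonneg_right (hd _ _ (by omega) j.2) (sq_nonneg _)
  exact le_of_mul_le_mul_right (h1.trans (hquad ▸ h2)) hpos

/-- Negating both sequences and reversing their order keeps them decreasing and turns the upper
bound into the lower one. -/
theorem le_diagonal_compression {N n : ℕ} (d e : ℕ → ℝ)
    (hd : ∀ i j, i ≤ j → j < N → d j ≤ d i) (he : ∀ i j, i ≤ j → j < n → e j ≤ e i)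
    (X : Matrix (Fin N) (Fin n) ℝ) (hX : Xᵀ * X = 1)
    (hXd : Xᵀ * Matrix.diagonal (fun i : Fin N => d i) * X = Matrix.diagonal (fun i : Fin n => e i))
    {i : ℕ} (hi : i < n) (hnN : n ≤ N) : d (N - n + i) ≤ e i := by
  have key := diagonal_compression_le (N := N) (n := n) (fun j => -d (N - 1 - j))
    (fun j => -e (n - 1 - j))
    (fun i j hij hj => neg_le_neg (hd _ _ (by omega) (by omega)))
    (fun i j hij hj => neg_le_neg (he _ _ (by omega) (by omega)))
    (X.submatrix Fin.revPerm Fin.revPerm)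
    (by
      rw [Matrix.transpose_submatrix, Matrix.submatrix_mul_equiv, hX]
      simp)
    (by
      have hr : ∀ (m : ℕ) (f : ℕ → ℝ), Matrix.diagonal (fun i : Fin m => -f (m - 1 - i))
          = (-Matrix.diagonal (fun i : Fin m => f i)).submatrix Fin.revPerm Fin.revPerm := by
        intro m f
        rw [Matrix.diagonal_neg, Matrix.submatrix_diagonal_equiv]
        congr 1
        funext k
        simp only [Function.comp_apply, Fin.revPerm_apply, Fin.val_rev]
        congr 2
        omega
      rw [hr, hr, Matrix.transpose_submatrix, Matrix.submatrix_mul_equiv,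
        Matrix.submatrix_mul_equiv, ← hXd, Matrix.mul_neg, Matrix.neg_mul])
    (i := n - 1 - i) (by omega) hnN
  have := neg_le_neg_iff.1 key
  rwa [show N - 1 - (n - 1 - i) = N - n + i by omega, show n - 1 - (n - 1 - i) = i by omega] at this

section Interlacing

variable {N n : ℕ} {A : Matrix (Fin N) (Fin N) ℝ} {C : Matrix (Fin n) (Fin N) ℝ}

theorem isHermitian_compression (hA : A.IsHermitian) : (C * A * Cᵀ).IsHermitian := by
  simpa using Matrix.isHermitian_mul_mul_conjTranspose C hA

/-- Written in eigenbases Q of A and R of its compression, Cᵀ becomes the isometry Qᵀ Cᵀ R; this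
reduces interlacing to diagonal matrices. -/
theorem exists_diagonal_compression (hA : A.IsHermitian) (hC : C * Cᵀ = 1) :
    ∃ X : Matrix (Fin N) (Fin n) ℝ, Xᵀ * X = 1 ∧
      Xᵀ * Matrix.diagonal (fun i : Fin N => eig A (i + 1)) * X
        = Matrix.diagonal (fun i : Fin n => eig (C * A * Cᵀ) (i + 1)) := by
  obtain ⟨Q, hQ1, hQ2, hQ⟩ := exists_orthogonal_diagonalization hA
  obtain ⟨R, hR1, -, hR⟩ :=
    exists_orthogonal_diagonalization (isHermitian_compression (C := C) hA)
  refine ⟨Qᵀ * Cᵀ * R, ?_, ?_⟩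
  · calc (Qᵀ * Cᵀ * R)ᵀ * (Qᵀ * Cᵀ * R) = Rᵀ * (C * (Q * Qᵀ) * Cᵀ) * R := by
          simp only [Matrix.transpose_mul, Matrix.transpose_transpose, Matrix.mul_assoc]
      _ = 1 := by rw [hQ2, Matrix.mul_one, hC, Matrix.mul_one, hR1]
  · calc _ = Rᵀ * (C * (Q * Matrix.diagonal (fun i : Fin N => eig A (i + 1)) * Qᵀ) * Cᵀ) * R := by
          simp only [Matrix.transpose_mul, Matrix.transpose_transpose, Matrix.mul_assoc]
      _ = Rᵀ * (R * Matrix.diagonal (fun i : Fin n => eig (C * A * Cᵀ) (i + 1)) * Rᵀ) * R := by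
          rw [← hQ, ← hR]
      _ = (Rᵀ * R) * Matrix.diagonal (fun i : Fin n => eig (C * A * Cᵀ) (i + 1)) * (Rᵀ * R) := by
          simp only [Matrix.mul_assoc]
      _ = _ := by rw [hR1, Matrix.one_mul, Matrix.mul_one]

/-- Upper half of Cauchy interlacing. -/
theorem eig_compression_le (hA : A.IsHermitian) (hC : C * Cᵀ = 1) (hnN : n ≤ N) {i : ℕ}
    (hi : 1 ≤ i) (hin : i ≤ n) : eig (C * A * Cᵀ) i ≤ eig A i := by
  obtain ⟨X, hX, hXd⟩ := exists_diagonal_compression hA hC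
  have := diagonal_compression_le (fun i => eig A (i + 1)) (fun i => eig (C * A * Cᵀ) (i + 1))
    (fun i j hij hj => eig_antitone A (by omega) (by omega) (by omega))
    (fun i j hij hj => eig_antitone _ (by omega) (by omega) (by omega)) X hX hXd
    (i := i - 1) (by omega) hnN
  simpa only [Nat.sub_add_cancel hi] using this

/-- Lower half of Cauchy interlacing. -/
theorem le_eig_compression (hA : A.IsHermitian) (hC : C * Cᵀ = 1) (hnN : n ≤ N) {i : ℕ}
    (hi : 1 ≤ i) (hin : i ≤ n) : eig A (N - n + i) ≤ eig (C * A * Cᵀ) i := by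
  obtain ⟨X, hX, hXd⟩ := exists_diagonal_compression hA hC
  have := le_diagonal_compression (fun i => eig A (i + 1)) (fun i => eig (C * A * Cᵀ) (i + 1))
    (fun i j hij hj => eig_antitone A (by omega) (by omega) (by omega))
    (fun i j hij hj => eig_antitone _ (by omega) (by omega) (by omega)) X hX hXd
    (i := i - 1) (by omega) hnN
  rwa [show N - n + (i - 1) + 1 = N - n + i by omega, Nat.sub_add_cancel hi] at this

theorem eig_nonneg (hA : A.PosSemidef) (i : ℕ) : 0 ≤ eig A i := by
  rw [eig]
  split_ifs with h
  · have := hA.eigenvalues_nonneg ((Fintype.equivOfCardEq (Fintype.card_fin _))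
      (⟨i - 1, by rw [Fintype.card_fin]; omega⟩ : Fin (Fintype.card (Fin N))))
    rwa [Matrix.IsHermitian.eigenvalues, Equiv.symm_apply_apply] at this
  · exact le_rfl

end Interlacing

/-! ### Trace inequalities -/

section Trace

variable {N : ℕ} {A B : Matrix (Fin N) (Fin N) ℝ}

/-- `tr (A B) = ∑ a_i b_{σ i}`, averaged over permutations `σ`. -/
theorem exists_trace_mul_eq_sum_perm (hA : A.IsHermitian) (hB : B.IsHermitian) :
    ∃ w : Equiv.Perm (Fin N) → ℝ, (∀ σ, 0 ≤ w σ) ∧ ∑ σ, w σ = 1 ∧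
      (A * B).trace = ∑ σ, w σ * ∑ i : Fin N, eig A (i + 1) * eig B (σ i + 1) := by
  obtain ⟨Q, hQ1, hQ2, hQ⟩ := exists_orthogonal_diagonalization hA
  obtain ⟨R, hR1, hR2, hR⟩ := exists_orthogonal_diagonalization hB
  have hY1 : (Qᵀ * R) * (Qᵀ * R)ᵀ = 1 := by
    calc _ = Qᵀ * (R * Rᵀ) * Q := by
          simp only [Matrix.transpose_mul, Matrix.transpose_transpose, Matrix.mul_assoc]
      _ = 1 := by rw [hR2, Matrix.mul_one, hQ1]
  have hY2 := mul_eq_one_comm.1 hY1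
  set Y := Qᵀ * R with hY
  -- The squared entries of an orthogonal matrix have unit row and column sums, so Birkhoff's
  -- theorem supplies the weights. The rearrangement inequality can then be applied to each
  -- permutation separately.
  have hM : (Matrix.of fun i j => Y i j ^ 2) ∈ doublyStochastic ℝ (Fin N) := by
    rw [mem_doublyStochastic_iff_sum]
    refine ⟨fun i j => sq_nonneg _, fun i => ?_, fun j => ?_⟩
    · have := congrFun (congrFun hY1 i) i
      rw [Matrix.mul_apply, Matrix.one_apply_eq] at this
      simpa [pow_two] using this
    · have := congrFun (congrFun hY2 j) j
      rw [Matrix.mul_apply, Matrix.one_apply_eq] at this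
      simpa [pow_two] using this
  obtain ⟨w, hw0, hw1, hw⟩ := exists_eq_sum_perm_of_mem_doublyStochastic hM
  refine ⟨w, hw0, hw1, ?_⟩
  have htr : (A * B).trace = ∑ i : Fin N, ∑ j : Fin N,
      eig A (i + 1) * eig B (j + 1) * (Matrix.of fun i j => Y i j ^ 2) i j := by
    calc (A * B).trace
        = ((Q * Matrix.diagonal (fun i : Fin N => eig A (i + 1)) * Qᵀ)
          * (R * Matrix.diagonal (fun i : Fin N => eig B (i + 1)) * Rᵀ)).trace := by
            rw [← hQ, ← hR]
      _ = (Matrix.diagonal (fun i : Fin N => eig A (i + 1)) * Y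
          * (Matrix.diagonal (fun i : Fin N => eig B (i + 1)) * Yᵀ)).trace := by
            rw [Matrix.mul_assoc Q, Matrix.mul_assoc Q, Matrix.trace_mul_comm, hY]
            simp only [Matrix.transpose_mul, Matrix.transpose_transpose, Matrix.mul_assoc]
      _ = _ := by
            rw [Matrix.trace]
            refine Finset.sum_congr rfl fun i _ => ?_
            rw [Matrix.diag_apply, Matrix.mul_apply]
            refine Finset.sum_congr rfl fun j _ => ?_
            rw [Matrix.diagonal_mul, Matrix.diagonal_mul, Matrix.transpose_apply, Matrix.of_apply]
            ring
  rw [htr, ← hw]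
  simp only [Matrix.sum_apply, Matrix.smul_apply, Finset.mul_sum, smul_eq_mul,
    Equiv.Perm.permMatrix, PEquiv.toMatrix_apply, Equiv.toPEquiv_apply, Option.mem_some_iff]
  rw [Finset.sum_congr rfl fun i _ => Finset.sum_comm, Finset.sum_comm]
  refine Finset.sum_congr rfl fun σ _ => Finset.sum_congr rfl fun i _ => ?_
  rw [Finset.sum_eq_single (σ i)]
  · simp only [if_true]
    ring
  · intro j _ hj
    rw [if_neg (Ne.symm hj)]
    ring
  · simp

/-- Von Neumann's trace inequality for real symmetric matrices. -/
theorem trace_mul_le_sum_eig (hA : A.IsHermitian) (hB : B.IsHermitian) :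
    (A * B).trace ≤ ∑ i ∈ Finset.Icc 1 N, eig A i * eig B i := by
  obtain ⟨w, hw0, hw1, hw⟩ := exists_trace_mul_eq_sum_perm hA hB
  have hmono : Monovary (fun i : Fin N => eig A (i + 1)) (fun i : Fin N => eig B (i + 1)) :=
    Antitone.monovary (fun i j hij => eig_antitone A (by omega) (by simpa using hij) (by omega))
      (fun i j hij => eig_antitone B (by omega) (by simpa using hij) (by omega))
  rw [sum_Icc_one_eq_sum_fin, hw, ← one_mul (∑ i : Fin N, _), ← hw1, Finset.sum_mul]
  refine Finset.sum_le_sum fun σ _ => mul_le_mul_of_nonneg_left ?_ (hw0 σ)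
  exact hmono.sum_smul_comp_perm_le_sum_smul (σ := σ)

theorem sum_eig_mul_eig_rev_le_trace_mul (hA : A.IsHermitian) (hB : B.IsHermitian) :
    ∑ i ∈ Finset.Icc 1 N, eig A i * eig B (N - i + 1) ≤ (A * B).trace := by
  obtain ⟨w, hw0, hw1, hw⟩ := exists_trace_mul_eq_sum_perm hA hB
  have hanti : Antivary (fun i : Fin N => eig A (i + 1))
      (fun i : Fin N => eig B (Fin.rev i + 1)) :=
    Antitone.antivary (fun i j hij => eig_antitone A (by omega) (by simpa using hij) (by omega))
      (fun i j hij => eig_antitone B (by omega) (by simp only [Fin.val_rev]; omega)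
        (by simp only [Fin.val_rev]; omega))
  rw [sum_Icc_one_eq_sum_fin, hw, ← one_mul (∑ i : Fin N, _), ← hw1, Finset.sum_mul]
  refine Finset.sum_le_sum fun σ _ => mul_le_mul_of_nonneg_left ?_ (hw0 σ)
  -- The second family is already reversed, so composing with the reversal makes σ act on the
  -- original order.
  have := hanti.sum_smul_le_sum_smul_comp_perm (σ := σ.trans Fin.revPerm)
  simpa [Fin.val_rev] using this

theorem trace_mul_self_eq_sum_eig_sq (hA : A.IsHermitian) :
    (A * A).trace = ∑ i ∈ Finset.Icc 1 N, eig A i ^ 2 := by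
  obtain ⟨Q, hQ1, hQ2, hQ⟩ := exists_orthogonal_diagonalization hA
  set D := Matrix.diagonal (fun i : Fin N => eig A (i + 1)) with hD
  calc (A * A).trace = ((Q * D * Qᵀ) * (Q * D * Qᵀ)).trace := by rw [← hQ]
    _ = (Q * (D * (Qᵀ * Q) * D * Qᵀ)).trace := by simp only [Matrix.mul_assoc]
    _ = (D * D).trace := by
        rw [Matrix.trace_mul_comm, hQ1, Matrix.mul_one, Matrix.mul_assoc, hQ1, Matrix.mul_one]
    _ = _ := by
        rw [sum_Icc_one_eq_sum_fin, hD, Matrix.diagonal_mul_diagonal, Matrix.trace_diagonal]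
        exact Finset.sum_congr rfl fun i _ => (pow_two _).symm

end Trace

/-! ### Spectral bounds for the loss under compression -/

section SpectralBounds

variable {N n : ℕ} {A B : Matrix (Fin N) (Fin N) ℝ} {C : Matrix (Fin n) (Fin N) ℝ}

theorem sum_Icc_split (hnN : n ≤ N) (f : ℕ → ℝ) :
    ∑ i ∈ Finset.Icc 1 N, f i = ∑ i ∈ Finset.Icc 1 n, f i + ∑ i ∈ Finset.Icc (n + 1) N, f i := by
  have := Finset.sum_Ico_consecutive f (show 1 ≤ n + 1 by omega) (show n + 1 ≤ N + 1 by omega)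
  exact this.symm

theorem trace_sq_sub_trace_compression_sq_le (hA : A.PosSemidef) (hC : C * Cᵀ = 1) (hnN : n ≤ N) :
    (A * A).trace - ((C * A * Cᵀ) * (C * A * Cᵀ)).trace ≤
      eig A (N - n + 1) * ∑ i ∈ Finset.Icc 1 n, (eig A i - eig (C * A * Cᵀ) i) + constU A n := by
  rw [trace_mul_self_eq_sum_eig_sq hA.1,
    trace_mul_self_eq_sum_eig_sq (isHermitian_compression hA.1), constU, sum_Icc_split hnN,
    Finset.mul_sum]
  suffices ∑ i ∈ Finset.Icc 1 n, eig A i ^ 2 ≤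
      ∑ i ∈ Finset.Icc 1 n, eig (C * A * Cᵀ) i ^ 2
      + ∑ i ∈ Finset.Icc 1 n, eig A (N - n + 1) * (eig A i - eig (C * A * Cᵀ) i)
      + ∑ i ∈ Finset.Icc 1 n, eig A i * (eig A i - eig A (N - n + i)) by linarith
  rw [← Finset.sum_add_distrib, ← Finset.sum_add_distrib]
  refine Finset.sum_le_sum fun i hi => ?_
  obtain ⟨hi1, hin⟩ := Finset.mem_Icc.1 hi
  have h1 := eig_compression_le hA.1 hC hnN hi1 hin
  have h2 := le_eig_compression hA.1 hC hnN hi1 hin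
  have h3 : eig A (N - n + i) ≤ eig A (N - n + 1) :=
    eig_antitone A (by omega) (by omega) (by omega)
  have h4 := eig_nonneg hA (N - n + i)
  -- With λ = λ_i, μ the compressed eigenvalue, ℓ = λ_{N−n+i} and κ = λ_{N−n+1}, right minus left is
  -- (λ−μ)(κ−ℓ) + μ(μ−ℓ).
  nlinarith [mul_nonneg (sub_nonneg.2 h1) (sub_nonneg.2 h3),
    mul_nonneg (h4.trans h2) (sub_nonneg.2 h2)]

/-- The largest pairing of the two spectra bounds tr(AB) from above, and the oppositely ordered
pairing bounds the compressed trace from below. Interlacing compares them index by index. -/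
theorem trace_mul_sub_trace_compression_mul_le (hA : A.PosSemidef) (hB : B.PosSemidef)
    (hC : C * Cᵀ = 1) (hnN : n ≤ N) :
    (A * B).trace - ((C * A * Cᵀ) * (C * B * Cᵀ)).trace ≤
      eig B (N - n + 1) * ∑ i ∈ Finset.Icc 1 n, (eig A i - eig (C * A * Cᵀ) i)
        + constUV A B n := by
  have hup := trace_mul_le_sum_eig hA.1 hB.1
  have hlow := sum_eig_mul_eig_rev_le_trace_mul (isHermitian_compression (C := C) hA.1)
    (isHermitian_compression (C := C) hB.1)
  rw [sum_Icc_split hnN] at hup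
  rw [constUV, Finset.mul_sum]
  have hAc : (C * A * Cᵀ).PosSemidef := by
    simpa using hA.mul_mul_conjTranspose_same C
  suffices ∑ i ∈ Finset.Icc 1 n, eig A i * eig B i ≤
      ∑ i ∈ Finset.Icc 1 n, eig (C * A * Cᵀ) i * eig (C * B * Cᵀ) (n - i + 1)
      + ∑ i ∈ Finset.Icc 1 n, eig B (N - n + 1) * (eig A i - eig (C * A * Cᵀ) i)
      + ∑ i ∈ Finset.Icc 1 n, eig A i * (eig B i - eig B (N - i + 1)) by linarith
  rw [← Finset.sum_add_distrib, ← Finset.sum_add_distrib]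
  refine Finset.sum_le_sum fun i hi => ?_
  obtain ⟨hi1, hin⟩ := Finset.mem_Icc.1 hi
  have h1 := eig_compression_le hA.1 hC hnN hi1 hin
  have h2 := le_eig_compression hB.1 hC hnN (i := n - i + 1) (by omega) (by omega)
  -- The opposite pairing at n − i + 1 interlaces with N − i + 1, the index appearing in `constUV`.
  rw [show N - n + (n - i + 1) = N - i + 1 by omega] at h2
  have h3 : eig B (N - i + 1) ≤ eig B (N - n + 1) :=
    eig_antitone B (by omega) (by omega) (by omega)
  -- With a, a′ the i-th eigenvalues of A and CACᵀ, b′ the (n−i+1)-th of CBCᵀ, and ℓ, κ those of B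
  -- at N−i+1 and N−n+1, right minus left is (a−a′)(κ−ℓ) + a′(b′−ℓ).
  nlinarith [mul_nonneg (sub_nonneg.2 h1) (sub_nonneg.2 h3),
    mul_nonneg (eig_nonneg hAc i) (sub_nonneg.2 h2)]

end SpectralBounds

/-! ### Partitions and the matrix form of the cost -/

namespace NodePartition

variable {N n : ℕ}

theorem card_le (P : NodePartition N n) : n ≤ N := by
  choose f hf using P.nonempty
  have hinj : Function.Injective f := fun k l hkl =>
    (P.exists_unique_mem (f k)).unique (hf k) (hkl ▸ hf l)
  simpa using Fintype.card_le_of_injective f hinj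

theorem Cp_nonneg (P : NodePartition N n) (k : Fin n) (i : Fin N) : 0 ≤ P.Cp k i := by
  rw [Cp, Matrix.of_apply]
  split_ifs <;> norm_num

theorem transpose_Cp_mulVec_one (P : NodePartition N n) : P.Cpᵀ *ᵥ 1 = 1 := by
  funext i
  obtain ⟨k, hk, huniq⟩ := P.exists_unique_mem i
  rw [Matrix.mulVec, dotProduct, Finset.sum_eq_single k]
  · simp [Cp, hk]
  · intro l _ hl
    have : i ∉ P.block l := fun h => hl (huniq l h)
    simp [Cp, this]
  · simp

end NodePartition

namespace MeasureGraph

variable {N N₁ N₂ n n₁ n₂ : ℕ}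

theorem sqrtW_mul_sqrtW (G : MeasureGraph N) : G.sqrtW * G.sqrtW = G.W := by
  rw [sqrtW, Matrix.diagonal_mul_diagonal, W]
  congr 1
  funext i
  exact Real.mul_self_sqrt (G.mass_pos i).le

theorem sqrtW_mul_invSqrtW (G : MeasureGraph N) : G.sqrtW * G.invSqrtW = 1 := by
  rw [sqrtW, invSqrtW, Matrix.diagonal_mul_diagonal, ← Matrix.diagonal_one]
  congr 1
  funext i
  exact mul_inv_cancel₀ (Real.sqrt_pos.2 (G.mass_pos i)).ne'

theorem invSqrtW_mul_sqrtW (G : MeasureGraph N) : G.invSqrtW * G.sqrtW = 1 :=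
  mul_eq_one_comm.1 G.sqrtW_mul_invSqrtW

@[simp] theorem transpose_sqrtW (G : MeasureGraph N) : G.sqrtWᵀ = G.sqrtW :=
  Matrix.diagonal_transpose _

@[simp] theorem transpose_invSqrtW (G : MeasureGraph N) : G.invSqrtWᵀ = G.invSqrtW :=
  Matrix.diagonal_transpose _

@[simp] theorem transpose_W (G : MeasureGraph N) : G.Wᵀ = G.W :=
  Matrix.diagonal_transpose _

theorem posSemidef_U {G : MeasureGraph N} (hS : G.sim.PosSemidef) : G.U.PosSemidef := by
  simpa [U] using hS.mul_mul_conjTranspose_same G.sqrtW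

theorem transpose_U {G : MeasureGraph N} (hS : G.simᵀ = G.sim) : G.Uᵀ = G.U := by
  simp only [U, Matrix.transpose_mul, transpose_sqrtW, hS, Matrix.mul_assoc]

theorem V₁_eq (G₁ : MeasureGraph N₁) (G₂ : MeasureGraph N₂) (T : Matrix (Fin N₁) (Fin N₂) ℝ) :
    G₁.V₁ G₂ T = normPlan G₁ G₂ T * G₂.U * (normPlan G₁ G₂ T)ᵀ := by
  simp only [V₁, U, Matrix.mul_assoc]

theorem V₂_eq (G₁ : MeasureGraph N₁) (G₂ : MeasureGraph N₂) (T : Matrix (Fin N₁) (Fin N₂) ℝ) :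
    G₁.V₂ G₂ T = (normPlan G₁ G₂ T)ᵀ * G₁.U * normPlan G₁ G₂ T := by
  simp only [V₂, U, Matrix.mul_assoc]

theorem trace_U_mul_U {G : MeasureGraph N} (hS : G.simᵀ = G.sim) :
    (G.U * G.U).trace = ∑ i, ∑ j, G.sim i j ^ 2 * G.mass i * G.mass j := by
  rw [Matrix.trace]
  refine Finset.sum_congr rfl fun i _ => ?_
  rw [Matrix.diag_apply, Matrix.mul_apply]
  refine Finset.sum_congr rfl fun j _ => ?_
  have hji : G.sim j i = G.sim i j := congrFun (congrFun hS i) j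
  have hi := Real.mul_self_sqrt (G.mass_pos i).le
  have hj := Real.mul_self_sqrt (G.mass_pos j).le
  simp only [U, sqrtW, Matrix.mul_diagonal, Matrix.diagonal_mul, hji]
  calc _ = G.sim i j ^ 2 * (√(G.mass i) * √(G.mass i)) * (√(G.mass j) * √(G.mass j)) := by ring
    _ = _ := by rw [hi, hj]

theorem trace_cross (G₁ : MeasureGraph N₁) (G₂ : MeasureGraph N₂)
    (T : Matrix (Fin N₁) (Fin N₂) ℝ) :
    (G₁.U * normPlan G₁ G₂ T * G₂.U * (normPlan G₁ G₂ T)ᵀ).trace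
      = (G₁.sim * T * G₂.sim * Tᵀ).trace := by
  have h1 := G₁.sqrtW_mul_invSqrtW
  have h2 := G₁.invSqrtW_mul_sqrtW
  have h3 := G₂.sqrtW_mul_invSqrtW
  have h4 := G₂.invSqrtW_mul_sqrtW
  calc _ = (G₁.sqrtW * (G₁.sim * (G₁.sqrtW * G₁.invSqrtW) * T * (G₂.invSqrtW * G₂.sqrtW) * G₂.sim
          * (G₂.sqrtW * G₂.invSqrtW) * Tᵀ * G₁.invSqrtW)).trace := by
        simp only [U, normPlan, Matrix.transpose_mul, transpose_invSqrtW, Matrix.mul_assoc]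
    _ = _ := by
        rw [Matrix.trace_mul_comm, h1, h3, h4, Matrix.mul_assoc _ G₁.invSqrtW, h2]
        simp only [Matrix.mul_one]

/-- Expanding the square, the marginal conditions collapse the two pure terms to mass-weighted sums;
in the mixed term the square roots of the masses cancel. -/
theorem cost_eq {G₁ : MeasureGraph N₁} {G₂ : MeasureGraph N₂} (hS₁ : G₁.simᵀ = G₁.sim)
    (hS₂ : G₂.simᵀ = G₂.sim) {T : Matrix (Fin N₁) (Fin N₂) ℝ} (hT : T ∈ couplings G₁ G₂) :
    cost G₁ G₂ T = (G₁.U * G₁.U).trace + (G₂.U * G₂.U).trace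
      - 2 * (G₁.U * normPlan G₁ G₂ T * G₂.U * (normPlan G₁ G₂ T)ᵀ).trace := by
  obtain ⟨-, hrow, hcol⟩ := hT
  have e1 : ∑ i, ∑ j, ∑ i', ∑ j', G₁.sim i j ^ 2 * (T i i' * T j j') = (G₁.U * G₁.U).trace := by
    rw [trace_U_mul_U hS₁]
    refine Finset.sum_congr rfl fun i _ => Finset.sum_congr rfl fun j _ => ?_
    simp only [← Finset.mul_sum, hrow, ← Finset.sum_mul]
    ring
  have e2 : ∑ i, ∑ j, ∑ i', ∑ j', G₂.sim i' j' ^ 2 * (T i i' * T j j') = (G₂.U * G₂.U).trace := by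
    rw [trace_U_mul_U hS₂]
    calc _ = ∑ i', ∑ j', ∑ i, ∑ j, G₂.sim i' j' ^ 2 * (T i i' * T j j') := by
          rw [Finset.sum_congr rfl fun i _ => Finset.sum_comm, Finset.sum_comm]
          refine Finset.sum_congr rfl fun i' _ => ?_
          rw [Finset.sum_congr rfl fun i _ => Finset.sum_comm, Finset.sum_comm]
      _ = _ := by
          refine Finset.sum_congr rfl fun i _ => Finset.sum_congr rfl fun j _ => ?_
          simp only [← Finset.mul_sum, hcol, ← Finset.sum_mul]
          ring
  have e3 : ∑ i, ∑ j, ∑ i', ∑ j', G₁.sim i j * G₂.sim i' j' * (T i i' * T j j')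
      = (G₁.U * normPlan G₁ G₂ T * G₂.U * (normPlan G₁ G₂ T)ᵀ).trace := by
    rw [trace_cross, Matrix.mul_assoc, Matrix.mul_assoc, Matrix.trace]
    refine Finset.sum_congr rfl fun i _ => ?_
    rw [Matrix.diag_apply, Matrix.mul_apply]
    refine Finset.sum_congr rfl fun j _ => ?_
    rw [Matrix.mul_apply, Finset.mul_sum, Finset.sum_comm]
    refine Finset.sum_congr rfl fun j' _ => ?_
    rw [Matrix.mul_apply, Finset.mul_sum, Finset.mul_sum]
    refine Finset.sum_congr rfl fun i' _ => ?_
    have hs : G₂.sim j' i' = G₂.sim i' j' := congrFun (congrFun hS₂ i') j'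
    rw [Matrix.transpose_apply, hs]
    ring
  rw [← e1, ← e2, ← e3, cost]
  simp only [Finset.mul_sum, ← Finset.sum_add_distrib, ← Finset.sum_sub_distrib]
  refine Finset.sum_congr rfl fun i _ => Finset.sum_congr rfl fun j _ =>
    Finset.sum_congr rfl fun i' _ => Finset.sum_congr rfl fun j' _ => ?_
  rw [sq_abs]
  ring

theorem cost_nonneg {G₁ : MeasureGraph N₁} {G₂ : MeasureGraph N₂}
    {T : Matrix (Fin N₁) (Fin N₂) ℝ} (hT : T ∈ couplings G₁ G₂) : 0 ≤ cost G₁ G₂ T :=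
  Finset.sum_nonneg fun i _ => Finset.sum_nonneg fun j _ => Finset.sum_nonneg fun i' _ =>
    Finset.sum_nonneg fun j' _ =>
      mul_nonneg (mul_nonneg (sq_nonneg _) (hT.1 i i')) (hT.1 j j')

theorem IsOptimalPlan.GW2_sq {G₁ : MeasureGraph N₁} {G₂ : MeasureGraph N₂}
    {T : Matrix (Fin N₁) (Fin N₂) ℝ} (hT : G₁.IsOptimalPlan G₂ T) :
    G₁.GW2 G₂ ^ 2 = cost G₁ G₂ T := by
  have h : IsLeast (cost G₁ G₂ '' couplings G₁ G₂) (cost G₁ G₂ T) :=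
    ⟨⟨T, hT.1, rfl⟩, by rintro _ ⟨T', hT', rfl⟩; exact hT.2 T' hT'⟩
  rw [GW2, h.csInf_eq, Real.sq_sqrt (cost_nonneg hT.1)]

/-- The graph with the masses of `G` whose matrix `U` is `X`. -/
noncomputable def withU (G : MeasureGraph N) (X : Matrix (Fin N) (Fin N) ℝ) : MeasureGraph N where
  mass := G.mass
  sim := G.invSqrtW * X * G.invSqrtW
  mass_pos := G.mass_pos
  mass_sum := G.mass_sum

theorem U_withU (G : MeasureGraph N) (X : Matrix (Fin N) (Fin N) ℝ) : (G.withU X).U = X := by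
  change G.sqrtW * (G.invSqrtW * X * G.invSqrtW) * G.sqrtW = X
  calc _ = (G.sqrtW * G.invSqrtW) * X * (G.invSqrtW * G.sqrtW) := by simp only [Matrix.mul_assoc]
    _ = X := by rw [sqrtW_mul_invSqrtW, invSqrtW_mul_sqrtW, Matrix.one_mul, Matrix.mul_one]

/-- For `P` the normalization of a coupling, `2 tr (X P Y Pᵀ) ≤ tr (X²) + tr (Y²)`. -/
theorem two_mul_trace_le {G₁ : MeasureGraph N₁} {G₂ : MeasureGraph N₂}
    {T : Matrix (Fin N₁) (Fin N₂) ℝ} (hT : T ∈ couplings G₁ G₂)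
    {X : Matrix (Fin N₁) (Fin N₁) ℝ} {Y : Matrix (Fin N₂) (Fin N₂) ℝ} (hX : Xᵀ = X) (hY : Yᵀ = Y) :
    2 * (X * normPlan G₁ G₂ T * Y * (normPlan G₁ G₂ T)ᵀ).trace ≤
      (X * X).trace + (Y * Y).trace := by
  have hsym : ∀ {N : ℕ} (G : MeasureGraph N) (X : Matrix (Fin N) (Fin N) ℝ), Xᵀ = X →
      (G.withU X).simᵀ = (G.withU X).sim := by
    intro N G X hX
    simp only [withU, Matrix.transpose_mul, transpose_invSqrtW, hX, Matrix.mul_assoc]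
  have hT' : T ∈ couplings (G₁.withU X) (G₂.withU Y) := hT
  -- `couplings` sees only the masses, so T also couples the graphs whose normalized similarities
  -- are X and Y. The claim is that its cost there is nonnegative, and X, Y need not be positive
  -- semidefinite.
  have h0 := cost_nonneg hT'
  rw [cost_eq (hsym _ X hX) (hsym _ Y hY) hT', U_withU, U_withU] at h0
  have : normPlan (G₁.withU X) (G₂.withU Y) T = normPlan G₁ G₂ T := rfl
  rw [this] at h0
  linarith

theorem mem_couplings_iff {G₁ : MeasureGraph N₁} {G₂ : MeasureGraph N₂}
    {T : Matrix (Fin N₁) (Fin N₂) ℝ} :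
    T ∈ couplings G₁ G₂ ↔ (∀ i j, 0 ≤ T i j) ∧ T *ᵥ 1 = G₁.mass ∧ Tᵀ *ᵥ 1 = G₂.mass := by
  simp only [couplings, Set.mem_ofPred_eq, funext_iff, Matrix.mulVec, dotProduct,
    Pi.one_apply, mul_one, Matrix.transpose_apply]

/-! ### Coarsening as an orthogonal compression -/

section Coarsening

variable (G : MeasureGraph N) (P : NodePartition N n)

theorem mul_entry_nonneg {l m k : ℕ} {A : Matrix (Fin l) (Fin m) ℝ} {B : Matrix (Fin m) (Fin k) ℝ}
    (hA : ∀ i j, 0 ≤ A i j) (hB : ∀ i j, 0 ≤ B i j) (i : Fin l) (j : Fin k) : 0 ≤ (A * B) i j := by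
  rw [Matrix.mul_apply]
  exact Finset.sum_nonneg fun x _ => mul_nonneg (hA i x) (hB x j)

theorem CwBar_nonneg (k : Fin n) (i : Fin N) : 0 ≤ G.CwBar P k i := by
  rw [CwBar, W, Matrix.mul_diagonal, Matrix.diagonal_mul]
  exact mul_nonneg (mul_nonneg (inv_nonneg.2 (G.blockMass_pos P k).le) (P.Cp_nonneg k i))
    (G.mass_pos i).le

theorem Cp_mulVec_mass : P.Cp *ᵥ G.mass = G.blockMass P := by
  funext k
  simp [NodePartition.Cp, Matrix.mulVec, dotProduct, blockMass, Finset.sum_ite_mem]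

theorem Cp_mul_W_mul_transpose_Cp : P.Cp * G.W * P.Cpᵀ = (G.coarsen P).W := by
  ext k l
  rw [Matrix.mul_apply, W, W, Matrix.diagonal_apply]
  simp only [Matrix.mul_diagonal, Matrix.transpose_apply]
  split_ifs with hkl
  · subst hkl
    change _ = G.blockMass P k
    rw [← Cp_mulVec_mass, Matrix.mulVec, dotProduct]
    refine Finset.sum_congr rfl fun i _ => ?_
    simp only [NodePartition.Cp, Matrix.of_apply]
    split_ifs <;> ring
  · refine Finset.sum_eq_zero fun i _ => ?_
    simp only [NodePartition.Cp, Matrix.of_apply]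
    split_ifs with h1 h2
    · exact absurd ((P.exists_unique_mem i).unique h1 h2) hkl
    · ring
    · ring
    · ring

theorem Cw_eq : G.Cw P = (G.coarsen P).invSqrtW * P.Cp * G.sqrtW := rfl

theorem CwBar_mul_invSqrtW : G.CwBar P * G.invSqrtW = (G.coarsen P).invSqrtW * G.Cw P := by
  have hc : Matrix.diagonal (fun k => (G.blockMass P k)⁻¹)
      = (G.coarsen P).invSqrtW * (G.coarsen P).invSqrtW := by
    rw [invSqrtW, Matrix.diagonal_mul_diagonal]
    congr 1
    funext k
    rw [← mul_inv]
    exact congrArg _ (Real.mul_self_sqrt (G.blockMass_pos P k).le).symm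
  rw [CwBar, hc, Cw_eq, ← sqrtW_mul_sqrtW]
  calc _ = (G.coarsen P).invSqrtW * ((G.coarsen P).invSqrtW * P.Cp * G.sqrtW)
        * (G.sqrtW * G.invSqrtW) := by simp only [Matrix.mul_assoc]
    _ = _ := by rw [sqrtW_mul_invSqrtW, Matrix.mul_one]

theorem CwBar_eq : G.CwBar P = (G.coarsen P).invSqrtW * G.Cw P * G.sqrtW := by
  rw [← CwBar_mul_invSqrtW, Matrix.mul_assoc, invSqrtW_mul_sqrtW, Matrix.mul_one]

/-- The rows are the vectors (√m_i) restricted to the disjoint blocks and normalized. -/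
theorem Cw_mul_transpose_Cw : G.Cw P * (G.Cw P)ᵀ = 1 := by
  rw [Cw_eq]
  calc _ = (G.coarsen P).invSqrtW * (P.Cp * (G.sqrtW * G.sqrtW) * P.Cpᵀ)
        * (G.coarsen P).invSqrtW := by
        simp only [Matrix.transpose_mul, transpose_sqrtW, transpose_invSqrtW, Matrix.mul_assoc]
    _ = ((G.coarsen P).invSqrtW * (G.coarsen P).sqrtW)
        * ((G.coarsen P).sqrtW * (G.coarsen P).invSqrtW) := by
        rw [sqrtW_mul_sqrtW, Cp_mul_W_mul_transpose_Cp, ← sqrtW_mul_sqrtW]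
        simp only [Matrix.mul_assoc]
    _ = 1 := by rw [sqrtW_mul_invSqrtW, invSqrtW_mul_sqrtW, Matrix.mul_one]

/-- This is where the choice of block averages matters: it makes the coarsened `U` a compression of
the original, so that interlacing applies. -/
theorem U_coarsen : (G.coarsen P).U = G.Uc P := by
  change (G.coarsen P).sqrtW * (G.CwBar P * G.sim * (G.CwBar P)ᵀ) * (G.coarsen P).sqrtW = _
  rw [CwBar_eq]
  calc _ = ((G.coarsen P).sqrtW * (G.coarsen P).invSqrtW) * G.Cw P * (G.sqrtW * G.sim * G.sqrtW)
        * (G.Cw P)ᵀ * ((G.coarsen P).invSqrtW * (G.coarsen P).sqrtW) := by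
        simp only [Matrix.transpose_mul, transpose_sqrtW, transpose_invSqrtW, Matrix.mul_assoc]
    _ = _ := by
        rw [sqrtW_mul_invSqrtW, invSqrtW_mul_sqrtW, Matrix.one_mul, Matrix.mul_one]
        rfl

theorem transpose_sim_coarsen {G : MeasureGraph N} (hS : G.simᵀ = G.sim) :
    (G.coarsen P).simᵀ = (G.coarsen P).sim := by
  simp only [coarsen, Matrix.transpose_mul, Matrix.transpose_transpose, hS, Matrix.mul_assoc]

theorem CwBar_mulVec_one : G.CwBar P *ᵥ 1 = 1 := by
  have hW : G.W *ᵥ 1 = G.mass := by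
    funext i
    simp [W, Matrix.mulVec_diagonal]
  rw [CwBar, ← Matrix.mulVec_mulVec, hW, ← Matrix.mulVec_mulVec, Cp_mulVec_mass]
  funext k
  rw [Matrix.mulVec_diagonal]
  exact inv_mul_cancel₀ (G.blockMass_pos P k).ne'

/-- The transpose distributes the mass of each block among its nodes in proportion to their masses;
this gives lifted plans the right marginals. -/
theorem transpose_CwBar_mulVec_blockMass : (G.CwBar P)ᵀ *ᵥ G.blockMass P = G.mass := by
  have h1 : Matrix.diagonal (fun k => (G.blockMass P k)⁻¹) *ᵥ G.blockMass P = 1 := by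
    funext k
    rw [Matrix.mulVec_diagonal]
    exact inv_mul_cancel₀ (G.blockMass_pos P k).ne'
  rw [CwBar, Matrix.transpose_mul, Matrix.transpose_mul, Matrix.diagonal_transpose,
    ← Matrix.mulVec_mulVec, ← Matrix.mulVec_mulVec, h1, P.transpose_Cp_mulVec_one, transpose_W]
  funext i
  simp [W, Matrix.mulVec_diagonal]

end Coarsening

/-! ### Passing plans between graphs and coarsenings -/

section Plans

variable {G₁ : MeasureGraph N₁} {G₂ : MeasureGraph N₂} {P₁ : NodePartition N₁ n₁}
  {P₂ : NodePartition N₂ n₂}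

/-- A plan between two graphs projects to their coarsenings. -/
theorem project_mem_couplings {T : Matrix (Fin N₁) (Fin N₂) ℝ} (hT : T ∈ couplings G₁ G₂) :
    P₁.Cp * T * P₂.Cpᵀ ∈ couplings (G₁.coarsen P₁) (G₂.coarsen P₂) := by
  obtain ⟨h0, h1, h2⟩ := mem_couplings_iff.1 hT
  refine mem_couplings_iff.2 ⟨mul_entry_nonneg (mul_entry_nonneg P₁.Cp_nonneg h0)
    (fun i j => P₂.Cp_nonneg j i), ?_, ?_⟩
  · rw [← Matrix.mulVec_mulVec, P₂.transpose_Cp_mulVec_one, ← Matrix.mulVec_mulVec, h1,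
      Cp_mulVec_mass]
    rfl
  · rw [Matrix.transpose_mul, Matrix.transpose_mul, Matrix.transpose_transpose,
      ← Matrix.mulVec_mulVec, ← Matrix.mulVec_mulVec, P₁.transpose_Cp_mulVec_one, h2,
      Cp_mulVec_mass]
    rfl

/-- A plan between two coarsenings lifts to the original graphs. -/
theorem lift_mem_couplings {T : Matrix (Fin n₁) (Fin n₂) ℝ}
    (hT : T ∈ couplings (G₁.coarsen P₁) (G₂.coarsen P₂)) :
    (G₁.CwBar P₁)ᵀ * T * G₂.CwBar P₂ ∈ couplings G₁ G₂ := by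
  obtain ⟨h0, h1, h2⟩ := mem_couplings_iff.1 hT
  refine mem_couplings_iff.2 ⟨mul_entry_nonneg
    (mul_entry_nonneg (fun i j => G₁.CwBar_nonneg P₁ j i) h0) (G₂.CwBar_nonneg P₂), ?_, ?_⟩
  · rw [← Matrix.mulVec_mulVec, CwBar_mulVec_one, ← Matrix.mulVec_mulVec, h1]
    exact transpose_CwBar_mulVec_blockMass G₁ P₁
  · rw [Matrix.transpose_mul, Matrix.transpose_mul, Matrix.transpose_transpose,
      ← Matrix.mulVec_mulVec, ← Matrix.mulVec_mulVec, CwBar_mulVec_one, h2]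
    exact transpose_CwBar_mulVec_blockMass G₂ P₂

theorem normPlan_project (T : Matrix (Fin N₁) (Fin N₂) ℝ) :
    normPlan (G₁.coarsen P₁) (G₂.coarsen P₂) (P₁.Cp * T * P₂.Cpᵀ)
      = G₁.Cw P₁ * normPlan G₁ G₂ T * (G₂.Cw P₂)ᵀ := by
  symm
  calc _ = (G₁.coarsen P₁).invSqrtW * P₁.Cp * (G₁.sqrtW * G₁.invSqrtW) * T
        * (G₂.invSqrtW * G₂.sqrtW) * P₂.Cpᵀ * (G₂.coarsen P₂).invSqrtW := by
        simp only [Cw_eq, normPlan, Matrix.transpose_mul, transpose_sqrtW, transpose_invSqrtW,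
          Matrix.mul_assoc]
    _ = _ := by
        rw [sqrtW_mul_invSqrtW, invSqrtW_mul_sqrtW, Matrix.mul_one, Matrix.mul_one]
        simp only [normPlan, Matrix.mul_assoc]

theorem normPlan_lift (T : Matrix (Fin n₁) (Fin n₂) ℝ) :
    normPlan G₁ G₂ ((G₁.CwBar P₁)ᵀ * T * G₂.CwBar P₂)
      = (G₁.Cw P₁)ᵀ * normPlan (G₁.coarsen P₁) (G₂.coarsen P₂) T * G₂.Cw P₂ := by
  calc _ = (G₁.invSqrtW * G₁.sqrtW) * (G₁.Cw P₁)ᵀ * ((G₁.coarsen P₁).invSqrtW * T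
        * (G₂.coarsen P₂).invSqrtW) * G₂.Cw P₂ * (G₂.sqrtW * G₂.invSqrtW) := by
        simp only [CwBar_eq, normPlan, Matrix.transpose_mul, transpose_sqrtW, transpose_invSqrtW,
          Matrix.mul_assoc]
    _ = _ := by
        rw [sqrtW_mul_invSqrtW, invSqrtW_mul_sqrtW, Matrix.mul_one, Matrix.one_mul, normPlan]

end Plans

/-! ### Comparison of the squared distances -/

/-- The squared distance drops by at most the loss of `‖U₁‖² + ‖U₂‖²` under coarsening. -/
theorem GW2_sq_le_coarsen {G₁ : MeasureGraph N₁} {G₂ : MeasureGraph N₂} (hS₁ : G₁.simᵀ = G₁.sim)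
    (hS₂ : G₂.simᵀ = G₂.sim) (P₁ : NodePartition N₁ n₁) (P₂ : NodePartition N₂ n₂) :
    G₁.GW2 G₂ ^ 2 ≤ (G₁.coarsen P₁).GW2 (G₂.coarsen P₂) ^ 2
      + ((G₁.U * G₁.U).trace - (G₁.Uc P₁ * G₁.Uc P₁).trace)
      + ((G₂.U * G₂.U).trace - (G₂.Uc P₂ * G₂.Uc P₂).trace) := by
  obtain ⟨T, hT⟩ := G₁.exists_isOptimalPlan G₂
  obtain ⟨T', hT'⟩ := (G₁.coarsen P₁).exists_isOptimalPlan (G₂.coarsen P₂)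
  have hle := hT.2 _ (lift_mem_couplings hT'.1)
  rw [hT.GW2_sq, hT'.GW2_sq, cost_eq (transpose_sim_coarsen P₁ hS₁) (transpose_sim_coarsen P₂ hS₂)
    hT'.1, U_coarsen, U_coarsen]
  rw [cost_eq hS₁ hS₂ (lift_mem_couplings hT'.1), normPlan_lift] at hle
  set Q := normPlan (G₁.coarsen P₁) (G₂.coarsen P₂) T'
  -- Lifting preserves the cross term: cyclicity of the trace moves `Cw` from the plan onto `U`.
  have htr : (G₁.U * ((G₁.Cw P₁)ᵀ * Q * G₂.Cw P₂) * G₂.U * ((G₁.Cw P₁)ᵀ * Q * G₂.Cw P₂)ᵀ).trace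
      = (G₁.Uc P₁ * Q * G₂.Uc P₂ * Qᵀ).trace := by
    rw [Uc, Uc]
    simp only [Matrix.transpose_mul, Matrix.transpose_transpose, Matrix.mul_assoc]
    rw [Matrix.trace_mul_comm (G₁.Cw P₁)]
    simp only [Matrix.mul_assoc]
  rw [htr] at hle
  linarith

/-- Pythagoras: CᵀC is an orthogonal projection, and U ↦ CᵀC U CᵀC is the orthogonal projection onto
its range for the trace inner product. -/
theorem trace_proj_sq {U : Matrix (Fin N) (Fin N) ℝ} {C : Matrix (Fin n) (Fin N) ℝ}
    (hC : C * Cᵀ = 1) :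
    ((U - Cᵀ * (C * U * Cᵀ) * C) * (U - Cᵀ * (C * U * Cᵀ) * C)).trace
      = (U * U).trace - ((C * U * Cᵀ) * (C * U * Cᵀ)).trace := by
  have h1 : (U * (Cᵀ * (C * U * Cᵀ) * C)).trace = ((C * U * Cᵀ) * (C * U * Cᵀ)).trace := by
    rw [← Matrix.mul_assoc, Matrix.trace_mul_comm]
    simp only [Matrix.mul_assoc]
  have h2 : (Cᵀ * (C * U * Cᵀ) * C * (Cᵀ * (C * U * Cᵀ) * C)).trace
      = ((C * U * Cᵀ) * (C * U * Cᵀ)).trace := by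
    calc _ = (Cᵀ * ((C * U * Cᵀ) * (C * Cᵀ) * (C * U * Cᵀ) * C)).trace := by
          simp only [Matrix.mul_assoc]
      _ = ((C * U * Cᵀ) * (C * U * Cᵀ) * (C * Cᵀ)).trace := by
          rw [hC, Matrix.trace_mul_comm, Matrix.mul_one, Matrix.mul_assoc _ C, hC]
      _ = _ := by rw [hC, Matrix.mul_one]
  rw [Matrix.sub_mul, Matrix.mul_sub, Matrix.mul_sub, Matrix.trace_sub, Matrix.trace_sub,
    Matrix.trace_sub, h2, Matrix.trace_mul_comm (Cᵀ * (C * U * Cᵀ) * C) U, h1]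
  ring

/-- The squared distance grows by at most twice the loss of the cross terms, each graph coarsened
separately. -/
theorem GW2_coarsen_sq_le {G₁ : MeasureGraph N₁} {G₂ : MeasureGraph N₂} (hS₁ : G₁.simᵀ = G₁.sim)
    (hS₂ : G₂.simᵀ = G₂.sim) (P₁ : NodePartition N₁ n₁) (P₂ : NodePartition N₂ n₂)
    {T : Matrix (Fin N₁) (Fin N₂) ℝ} (hT : G₁.IsOptimalPlan G₂ T) :
    (G₁.coarsen P₁).GW2 (G₂.coarsen P₂) ^ 2 ≤ G₁.GW2 G₂ ^ 2
      + 2 * (((G₁.U * G₁.V₁ G₂ T).trace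
          - (G₁.Uc P₁ * (G₁.Cw P₁ * G₁.V₁ G₂ T * (G₁.Cw P₁)ᵀ)).trace)
        + ((G₂.U * G₁.V₂ G₂ T).trace
          - (G₂.Uc P₂ * (G₂.Cw P₂ * G₁.V₂ G₂ T * (G₂.Cw P₂)ᵀ)).trace)) := by
  obtain ⟨T', hT'⟩ := (G₁.coarsen P₁).exists_isOptimalPlan (G₂.coarsen P₂)
  have hle := hT'.2 _ (project_mem_couplings hT.1)
  rw [hT.GW2_sq, hT'.GW2_sq, cost_eq hS₁ hS₂ hT.1, V₁_eq, V₂_eq]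
  rw [cost_eq (transpose_sim_coarsen P₁ hS₁) (transpose_sim_coarsen P₂ hS₂)
    (project_mem_couplings hT.1), normPlan_project, U_coarsen, U_coarsen] at hle
  set Q := normPlan G₁ G₂ T with hQ
  set X := (G₁.Cw P₁)ᵀ * G₁.Uc P₁ * G₁.Cw P₁ with hX
  set Y := (G₂.Cw P₂)ᵀ * G₂.Uc P₂ * G₂.Cw P₂ with hY
  have hUc₁ : (G₁.Uc P₁)ᵀ = G₁.Uc P₁ := by
    simp only [Uc, Matrix.transpose_mul, Matrix.transpose_transpose, transpose_U hS₁,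
      Matrix.mul_assoc]
  have hUc₂ : (G₂.Uc P₂)ᵀ = G₂.Uc P₂ := by
    simp only [Uc, Matrix.transpose_mul, Matrix.transpose_transpose, transpose_U hS₂,
      Matrix.mul_assoc]
  have hXt : Xᵀ = X := by
    simp only [hX, Matrix.transpose_mul, Matrix.transpose_transpose, hUc₁, Matrix.mul_assoc]
  have hYt : Yᵀ = Y := by
    simp only [hY, Matrix.transpose_mul, Matrix.transpose_transpose, hUc₂, Matrix.mul_assoc]
  have hXX : ((G₁.U - X) * (G₁.U - X)).trace
      = (G₁.U * G₁.U).trace - (G₁.Uc P₁ * G₁.Uc P₁).trace :=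
    trace_proj_sq (G₁.Cw_mul_transpose_Cw P₁)
  have hYY : ((G₂.U - Y) * (G₂.U - Y)).trace
      = (G₂.U * G₂.U).trace - (G₂.Uc P₂ * G₂.Uc P₂).trace :=
    trace_proj_sq (G₂.Cw_mul_transpose_Cw P₂)
  -- The minus sign on the second argument yields the bound for −2 tr((U₁−X)Q(U₂−Y)Qᵀ), the sign
  -- with which the mixed term enters.
  have hcross := two_mul_trace_le hT.1 (X := G₁.U - X) (Y := -(G₂.U - Y))
    (by rw [Matrix.transpose_sub, transpose_U hS₁, hXt])
    (by rw [Matrix.transpose_neg, Matrix.transpose_sub, transpose_U hS₂, hYt])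
  rw [neg_mul_neg, hXX, hYY, ← hQ] at hcross
  simp only [Matrix.mul_neg, Matrix.neg_mul, Matrix.trace_neg, Matrix.mul_sub, Matrix.sub_mul,
    Matrix.trace_sub] at hcross
  have e1 : (G₁.Uc P₁ * (G₁.Cw P₁ * Q * (G₂.Cw P₂)ᵀ) * G₂.Uc P₂
      * (G₁.Cw P₁ * Q * (G₂.Cw P₂)ᵀ)ᵀ).trace = (X * Q * Y * Qᵀ).trace := by
    rw [hX, hY]
    simp only [Matrix.transpose_mul, Matrix.transpose_transpose, Matrix.mul_assoc]
    rw [Matrix.trace_mul_comm (G₁.Cw P₁)ᵀ]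
    simp only [Matrix.mul_assoc]
  have e2 : (G₁.Uc P₁ * (G₁.Cw P₁ * (Q * G₂.U * Qᵀ) * (G₁.Cw P₁)ᵀ)).trace
      = (X * Q * G₂.U * Qᵀ).trace := by
    rw [hX]
    simp only [Matrix.mul_assoc]
    rw [Matrix.trace_mul_comm (G₁.Cw P₁)ᵀ]
    simp only [Matrix.mul_assoc]
  have e3 : (G₂.Uc P₂ * (G₂.Cw P₂ * (Qᵀ * G₁.U * Q) * (G₂.Cw P₂)ᵀ)).trace
      = (G₁.U * Q * Y * Qᵀ).trace := by
    rw [hY, Matrix.trace_mul_comm (G₂.Uc P₂)]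
    simp only [Matrix.mul_assoc]
    rw [Matrix.trace_mul_comm (G₂.Cw P₂)]
    simp only [Matrix.mul_assoc]
    rw [Matrix.trace_mul_comm Qᵀ]
    simp only [Matrix.mul_assoc]
  have e4 : (G₁.U * (Q * G₂.U * Qᵀ)).trace = (G₁.U * Q * G₂.U * Qᵀ).trace := by
    simp only [Matrix.mul_assoc]
  have e5 : (G₂.U * (Qᵀ * G₁.U * Q)).trace = (G₁.U * Q * G₂.U * Qᵀ).trace := by
    rw [Matrix.trace_mul_comm G₂.U]
    simp only [Matrix.mul_assoc]
    rw [Matrix.trace_mul_comm Qᵀ]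
    simp only [Matrix.mul_assoc]
  rw [e1] at hle
  rw [e2, e3, e4, e5]
  linarith

end MeasureGraph

end GraphCoarsening

theorem mainTheorem2 {N₁ N₂ n₁ n₂ : ℕ}
    (G₁ : MeasureGraph N₁) (G₂ : MeasureGraph N₂)
    (hS₁ : G₁.sim.PosSemidef) (hS₂ : G₂.sim.PosSemidef)
    (P₁ : NodePartition N₁ n₁) (P₂ : NodePartition N₂ n₂)
    (T : Matrix (Fin N₁) (Fin N₂) ℝ) (hT : G₁.IsOptimalPlan G₂ T) :
    |(G₁.coarsen P₁).GW2 (G₂.coarsen P₂) ^ 2 - G₁.GW2 G₂ ^ 2| ≤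
      max
        (eig G₁.U (N₁ - n₁ + 1) * G₁.specDiff P₁ + constU G₁.U n₁
          + eig G₂.U (N₂ - n₂ + 1) * G₂.specDiff P₂ + constU G₂.U n₂)
        (2 * (eig (G₁.V₁ G₂ T) (N₁ - n₁ + 1) * G₁.specDiff P₁
              + constUV G₁.U (G₁.V₁ G₂ T) n₁
            + eig (G₁.V₂ G₂ T) (N₂ - n₂ + 1) * G₂.specDiff P₂
              + constUV G₂.U (G₁.V₂ G₂ T) n₂)) := by
  have hU₁ := MeasureGraph.posSemidef_U hS₁
  have hU₂ := MeasureGraph.posSemidef_U hS₂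
  have hV₁ : (G₁.V₁ G₂ T).PosSemidef := by
    rw [MeasureGraph.V₁_eq]
    simpa using hU₂.mul_mul_conjTranspose_same (MeasureGraph.normPlan G₁ G₂ T)
  have hV₂ : (G₁.V₂ G₂ T).PosSemidef := by
    rw [MeasureGraph.V₂_eq]
    simpa using hU₁.conjTranspose_mul_mul_same (MeasureGraph.normPlan G₁ G₂ T)
  have hsym₁ : G₁.simᵀ = G₁.sim := by simpa [Matrix.IsHermitian] using hS₁.1
  have hsym₂ : G₂.simᵀ = G₂.sim := by simpa [Matrix.IsHermitian] using hS₂.1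
  have hC₁ := G₁.Cw_mul_transpose_Cw P₁
  have hC₂ := G₂.Cw_mul_transpose_Cw P₂
  have hlow := MeasureGraph.GW2_sq_le_coarsen hsym₁ hsym₂ P₁ P₂
  have hup := MeasureGraph.GW2_coarsen_sq_le hsym₁ hsym₂ P₁ P₂ hT
  have a₁ := trace_sq_sub_trace_compression_sq_le hU₁ hC₁ P₁.card_le
  have a₂ := trace_sq_sub_trace_compression_sq_le hU₂ hC₂ P₂.card_le
  have b₁ := trace_mul_sub_trace_compression_mul_le hU₁ hV₁ hC₁ P₁.card_le
  have b₂ := trace_mul_sub_trace_compression_mul_le hU₂ hV₂ hC₂ P₂.card_le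
  simp only [MeasureGraph.Uc, MeasureGraph.specDiff] at hlow hup ⊢
  rw [abs_le']
  constructor
  -- An increase of the distance is controlled by the cross-term losses, a decrease by the norm
  -- losses; hence the maximum.
  · exact le_max_of_le_right (by linarith)
  · exact le_max_of_le_left (by linarith)
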